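/- Let $\mathbb K=\mathbb R$ or $\mathbb C$, let $d\ge 2$ and let $\mathbb T^d=\mathbb R^d/(2\pi\mathbb Z)^d$ be the flat torus with its Lebesgue measure. For $k\in\mathbb N$ let $E_k\subset L^2(\mathbb T^d;\mathbb K)$ be the (finite-dimensional) space of smooth functions $f:\mathbb T^d\to\mathbb K$ with $-\Delta f=kf$, equipped with the $L^2$ norm, and let $\mathfrak S_d=\{k\in\mathbb N:\dim E_k\ge 1\}$ be the spectrum of $-\Delta$ (i.e. the set of integers that are sums of $d$ squares of integers). For $k\in\mathfrak S_d$ let $\mathbb S_k$ be the unit sphere of $E_k$, with its uniform probability measure, and equip the space $\prod_{k\in\mathfrak S_d}\mathbb S_k$ of sequences $U=(u_k)_{k\in\mathfrak S_d}$, $u_k\in\mathbb S_k$, with the product probability measure $\nu$. Then $$\nu\bigl(\{U:\ \exists C>0,\ \forall k\in\mathfrak S_d,\ \|u_k\|_{L^\infty(\mathbb T^d)}\le C\}\bigr)=0 ,$$ that is, almost surely the sequence $(u_k)$ is not bounded in $L^\infty(\mathbb T^d)$. -/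

import Mathlib

open MeasureTheory Set Metric
open scoped ContDiff

noncomputable section

instance twoPiPos : Fact (0 < 2 * Real.pi) := ⟨Real.two_pi_pos⟩

/-- The flat torus `ℝᵈ / (2πℤ)ᵈ`; its `volume` has total mass `(2π)ᵈ`. -/
abbrev FlatTorus (d : ℕ) : Type := Fin d → AddCircle (2 * Real.pi)

namespace FlatTorus

variable {d : ℕ}

/-- The covering map `ℝᵈ → ℝᵈ / (2πℤ)ᵈ`. -/
def proj (y : EuclideanSpace ℝ (Fin d)) : FlatTorus d := fun i => (y i : AddCircle (2 * Real.pi))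

variable {F : Type*} [NormedAddCommGroup F] [NormedSpace ℝ F]

/-- `f` is of class `C^∞` on the torus. -/
def Smooth (f : FlatTorus d → F) : Prop := ContDiff ℝ ∞ (fun y => f (proj y))

/-- The Laplacian `∑ ∂²f/∂xᵢ²` on the torus: `y ↦ x + proj y` is a local isometry of `ℝᵈ` onto
the torus which sends `0` to `x`. -/
def laplacian (f : FlatTorus d → F) (x : FlatTorus d) : F :=
  Laplacian.laplacian (fun y : EuclideanSpace ℝ (Fin d) => f (x + proj y)) 0

theorem two_le_infty : (2 : WithTop ℕ∞) ≤ ∞ := by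
  exact WithTop.coe_le_coe.2 (le_top : (2 : ℕ∞) ≤ ⊤)

theorem proj_add (y z : EuclideanSpace ℝ (Fin d)) : proj (y + z) = proj y + proj z := by
  ext i; simp [proj]

theorem proj_zero : proj (0 : EuclideanSpace ℝ (Fin d)) = 0 := by
  ext i; simp [proj]

theorem isOpenQuotientMap_proj : IsOpenQuotientMap (proj (d := d)) := by
  have h1 : IsOpenQuotientMap
      (Pi.map fun (_ : Fin d) (t : ℝ) => (t : AddCircle (2 * Real.pi))) :=
    IsOpenQuotientMap.piMap fun _ => QuotientAddGroup.isOpenQuotientMap_mk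
  exact h1.comp (EuclideanSpace.equiv (Fin d) ℝ).toHomeomorph.isOpenQuotientMap

theorem Smooth.translate {f : FlatTorus d → F} (hf : Smooth f) (x : FlatTorus d) :
    ContDiff ℝ ∞ (fun y => f (x + proj y)) := by
  obtain ⟨z, rfl⟩ := isOpenQuotientMap_proj.surjective x
  have : ContDiff ℝ ∞ ((fun y => f (proj y)) ∘ fun y => z + y) :=
    ContDiff.comp hf (contDiff_const.add contDiff_id)
  simpa [Function.comp_def, proj_add] using this

theorem Smooth.continuous {f : FlatTorus d → F} (hf : Smooth f) : Continuous f :=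
  isOpenQuotientMap_proj.isQuotientMap.continuous_iff.2 (ContDiff.continuous hf)

theorem Smooth.clm_comp {G : Type*} [NormedAddCommGroup G] [NormedSpace ℝ G]
    {f : FlatTorus d → F} (hf : Smooth f) (L : F →L[ℝ] G) : Smooth (fun x => L (f x)) :=
  L.contDiff.comp hf

theorem laplacian_clm_comp {G : Type*} [NormedAddCommGroup G] [NormedSpace ℝ G]
    {f : FlatTorus d → F} (hf : Smooth f) (L : F →L[ℝ] G) (x : FlatTorus d) :
    laplacian (fun x => L (f x)) x = L (laplacian f x) :=
  ContDiffAt.laplacian_CLM_comp_left (l := L)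
    (((hf.translate x).of_le two_le_infty).contDiffAt)

/-- The derivative of `f` in the direction `v`. -/
def dirDeriv (v : EuclideanSpace ℝ (Fin d)) (f : FlatTorus d → F) (x : FlatTorus d) : F :=
  fderiv ℝ (fun y => f (x + proj y)) 0 v

theorem fderiv_translate {f : FlatTorus d → F} (x : FlatTorus d)
    (y v : EuclideanSpace ℝ (Fin d)) :
    fderiv ℝ (fun y => f (x + proj y)) y v = dirDeriv v f (x + proj y) := by
  have := fderiv_comp_add_left (𝕜 := ℝ) (f := fun y => f (x + proj y)) (x := 0) y
  simp only [add_zero] at this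
  rw [← this, dirDeriv]
  simp [proj_add, add_assoc]

theorem Smooth.dirDeriv {f : FlatTorus d → F} (hf : Smooth f) (v : EuclideanSpace ℝ (Fin d)) :
    Smooth (dirDeriv v f) := by
  have h : ContDiff ℝ ∞ fun y => fderiv ℝ (fun y => f (0 + proj y)) y v :=
    ((hf.translate 0).fderiv_right (m := ∞) (by simp)).clm_apply contDiff_const
  have e : (fun y => fderiv ℝ (fun y => f (0 + proj y)) y v) =
      fun y => FlatTorus.dirDeriv v f (proj y) := by
    funext y
    rw [fderiv_translate, zero_add]
  rw [e] at h
  exact h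

theorem laplacian_eq_sum {f : FlatTorus d → F} (hf : Smooth f) (x : FlatTorus d) :
    laplacian f x = ∑ i, dirDeriv (EuclideanSpace.single i 1)
      (dirDeriv (EuclideanSpace.single i 1) f) x := by
  rw [laplacian, InnerProductSpace.laplacian_eq_iteratedFDeriv_orthonormalBasis _
    (EuclideanSpace.basisFun (Fin d) ℝ)]
  refine Finset.sum_congr rfl fun i _ => ?_
  rw [iteratedFDeriv_two_apply]
  simp only [EuclideanSpace.basisFun_apply, Matrix.cons_val_zero, Matrix.cons_val_one]
  have h2 : DifferentiableAt ℝ (fderiv ℝ fun y => f (x + proj y)) 0 :=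
    ((hf.translate x).fderiv_right (m := ∞) (by simp)).differentiable (by simp) |>.differentiableAt
  have := (h2.hasFDerivAt.clm_apply (hasFDerivAt_const (EuclideanSpace.single i (1:ℝ)) 0)).fderiv
  simp only [fderiv_translate] at this
  conv_rhs => rw [FlatTorus.dirDeriv, this]
  simp

section
variable {𝕂 : Type*} [RCLike 𝕂]

/-- The space of smooth functions `f` on the torus with `-Δf = k f`. -/
def smoothEigenfunctions (𝕂 : Type*) [RCLike 𝕂] (d k : ℕ) : Submodule 𝕂 C(FlatTorus d, 𝕂) where
  carrier := {f | Smooth f ∧ ∀ x, -laplacian f x = (k : 𝕂) * f x}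
  zero_mem' := by
    refine ⟨contDiff_const, fun x => ?_⟩
    simp [laplacian]
  add_mem' := by
    rintro f g ⟨hf, hf'⟩ ⟨hg, hg'⟩
    refine ⟨ContDiff.add hf hg, fun x => ?_⟩
    have : laplacian (f + g : C(FlatTorus d, 𝕂)) x = laplacian f x + laplacian g x :=
      ContDiffAt.laplacian_add
        ((hf.translate x).of_le two_le_infty).contDiffAt
        ((hg.translate x).of_le two_le_infty).contDiffAt
    rw [this, neg_add, hf', hg', ContinuousMap.add_apply, mul_add]
  smul_mem' := by
    rintro c f ⟨hf, hf'⟩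
    refine ⟨hf.clm_comp (ContinuousLinearMap.lsmul ℝ 𝕂 c), fun x => ?_⟩
    have : laplacian (c • f : C(FlatTorus d, 𝕂)) x = c • laplacian f x :=
      laplacian_clm_comp hf (ContinuousLinearMap.lsmul ℝ 𝕂 c) x
    rw [this, ← smul_neg, hf', ContinuousMap.smul_apply, smul_eq_mul, smul_eq_mul, mul_left_comm]


/-- The dilation `(ℝ/ℤ)ᵈ → (ℝ/2πℤ)ᵈ`. -/
def scale (t : UnitAddTorus (Fin d)) : FlatTorus d :=
  fun i => AddCircle.homeomorphAddCircle 1 (2 * Real.pi) one_ne_zero Real.two_pi_pos.ne' (t i)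

/-- The Haar probability measure of `(ℝ/ℤ)ᵈ`. -/
abbrev unitHaar (d : ℕ) : Measure (UnitAddTorus (Fin d)) :=
  Measure.pi fun _ => AddCircle.haarAddCircle

/-- The dilation `ℝᵈ → (ℝ/ℤ)ᵈ`. -/
def unscale (y : EuclideanSpace ℝ (Fin d)) : UnitAddTorus (Fin d) :=
  fun i => ((y i / (2 * Real.pi) : ℝ) : UnitAddCircle)

theorem continuous_scale : Continuous (scale (d := d)) := by
  unfold scale; fun_prop

theorem scale_surjective : Function.Surjective (scale (d := d)) := by
  intro x
  refine ⟨fun i => (AddCircle.homeomorphAddCircle 1 (2 * Real.pi) one_ne_zero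
    Real.two_pi_pos.ne').symm (x i), ?_⟩
  ext i
  simp only [scale, Homeomorph.apply_symm_apply]

theorem scale_add_unscale (t : UnitAddTorus (Fin d)) (y : EuclideanSpace ℝ (Fin d)) :
    scale (t + unscale y) = scale t + proj y := by
  ext i
  simp only [scale, unscale, proj, Pi.add_apply]
  obtain ⟨s, hs⟩ := QuotientAddGroup.mk_surjective (t i)
  rw [← hs]
  change AddCircle.homeomorphAddCircle 1 (2 * Real.pi) one_ne_zero Real.two_pi_pos.ne'
    ((s : UnitAddCircle) + ((y i / (2 * Real.pi) : ℝ) : UnitAddCircle)) =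
    AddCircle.homeomorphAddCircle 1 (2 * Real.pi) one_ne_zero Real.two_pi_pos.ne'
    (s : UnitAddCircle) + _
  rw [← AddCircle.coe_add, AddCircle.homeomorphAddCircle_apply_mk,
    AddCircle.homeomorphAddCircle_apply_mk, ← AddCircle.coe_add]
  congr 1
  have := Real.pi_pos.ne'
  field_simp

open UnitAddTorus in
theorem mFourier_add_apply (n : Fin d → ℤ) (s t : UnitAddTorus (Fin d)) :
    mFourier n (s + t) = mFourier n s * mFourier n t := by
  simp [mFourier, fourier_apply, AddCircle.toCircle_add, Finset.prod_mul_distrib]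

open UnitAddTorus in
theorem mFourier_neg_unscale (n : Fin d → ℤ) (y : EuclideanSpace ℝ (Fin d)) :
    mFourier (-n) (-unscale y) = Complex.exp (Complex.I * ∑ i, (n i : ℂ) * (y i : ℂ)) := by
  rw [Finset.mul_sum, Complex.exp_sum]
  simp only [mFourier, ContinuousMap.coe_mk]
  refine Finset.prod_congr rfl fun i _ => ?_
  rw [Pi.neg_apply, Pi.neg_apply, unscale, ← AddCircle.coe_neg, fourier_coe_apply]
  congr 1
  have : (Real.pi : ℂ) ≠ 0 := by exact_mod_cast Real.pi_pos.ne'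
  push_cast
  field_simp

open UnitAddTorus in
theorem mFourierCoeff_translate (f : FlatTorus d → ℂ) (n : Fin d → ℤ)
    (y : EuclideanSpace ℝ (Fin d)) :
    ∫ t, mFourier (-n) t * f (scale t + proj y) ∂unitHaar d =
      Complex.exp (Complex.I * ∑ i, (n i : ℂ) * (y i : ℂ)) *
        ∫ t, mFourier (-n) t * f (scale t) ∂unitHaar d := by
  rw [← integral_add_right_eq_self (fun t => mFourier (-n) t * f (scale t)) (unscale y),
    ← integral_const_mul]
  refine integral_congr_ae (Filter.Eventually.of_forall fun t => ?_)
  have : mFourier (-n) t = mFourier (-n) (-unscale y) * mFourier (-n) (t + unscale y) := by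
    rw [← mFourier_add_apply]; simp
  simp only [scale_add_unscale]
  rw [this, mFourier_neg_unscale, mul_assoc]

open UnitAddTorus in
theorem mFourierCoeff_dirDeriv {f : FlatTorus d → ℂ} (hf : Smooth f) (n : Fin d → ℤ)
    (v : EuclideanSpace ℝ (Fin d)) :
    ∫ t, mFourier (-n) t * dirDeriv v f (scale t) ∂unitHaar d =
      (Complex.I * ∑ i, (n i : ℂ) * (v i : ℂ)) * ∫ t, mFourier (-n) t * f (scale t) ∂unitHaar d := by
  have hD : Continuous (dirDeriv v f) := (hf.dirDeriv v).continuous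
  obtain ⟨C, hC⟩ : ∃ C, ∀ x, ‖dirDeriv v f x‖ ≤ C := by
    obtain ⟨C, hC⟩ := isCompact_univ.exists_bound_of_continuousOn hD.continuousOn
    exact ⟨C, fun x => hC x (mem_univ x)⟩
  have hderiv : ∀ (x : FlatTorus d) (s : ℝ), HasDerivAt (fun s : ℝ => f (x + proj (s • v)))
      (dirDeriv v f (x + proj (s • v))) s := by
    intro x s
    have h1 : HasFDerivAt (fun y => f (x + proj y))
        (fderiv ℝ (fun y => f (x + proj y)) (s • v)) (s • v) :=
      ((hf.translate x).differentiable (by simp)).differentiableAt.hasFDerivAt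
    have h2 : HasDerivAt (fun s : ℝ => s • v) v s := by
      simpa using (hasDerivAt_id s).smul_const v
    have := h1.comp_hasDerivAt s h2
    rwa [fderiv_translate] at this
  have hcont : ∀ s : ℝ, Continuous fun t => mFourier (-n) t * f (scale t + proj (s • v)) :=
    fun s => (mFourier (-n)).continuous.mul
      (hf.continuous.comp (continuous_scale.add continuous_const))
  have hcont' : ∀ s : ℝ,
      Continuous fun t => mFourier (-n) t * dirDeriv v f (scale t + proj (s • v)) :=
    fun s => (mFourier (-n)).continuous.mul
      (hD.comp (continuous_scale.add continuous_const))
  have key := (hasDerivAt_integral_of_dominated_loc_of_deriv_le (μ := unitHaar d) (𝕜 := ℝ)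
    (F := fun (s : ℝ) t => mFourier (-n) t * f (scale t + proj (s • v)))
    (F' := fun (s : ℝ) t => mFourier (-n) t * dirDeriv v f (scale t + proj (s • v)))
    (x₀ := 0) (s := univ) (bound := fun _ => C) Filter.univ_mem
    (Filter.Eventually.of_forall fun s => (hcont s).aestronglyMeasurable)
    ((hcont 0).integrable_of_hasCompactSupport (HasCompactSupport.of_compactSpace _))
    (hcont' 0).aestronglyMeasurable
    (Filter.Eventually.of_forall fun t s _ => by
      rw [norm_mul]
      have : ‖mFourier (-n) t‖ ≤ 1 := by
        simpa [mFourier_norm] using (mFourier (-n)).norm_coe_le_norm t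
      exact (mul_le_of_le_one_left (norm_nonneg _) this).trans (hC _))
    (integrable_const C)
    (Filter.Eventually.of_forall fun t s _ => (hderiv (scale t) s).const_mul _)).2
  simp only [mFourierCoeff_translate, zero_smul, proj_zero, add_zero] at key
  refine key.unique ?_
  have h3 : HasDerivAt (fun s : ℝ => Complex.I * ∑ i, (n i : ℂ) * (((s • v) i : ℝ) : ℂ))
      (Complex.I * ∑ i, (n i : ℂ) * (v i : ℂ)) 0 := by
    have : (fun s : ℝ => Complex.I * ∑ i, (n i : ℂ) * (((s • v) i : ℝ) : ℂ)) =
        fun s : ℝ => (s : ℂ) * (Complex.I * ∑ i, (n i : ℂ) * (v i : ℂ)) := by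
      ext s
      simp only [PiLp.smul_apply, smul_eq_mul, Complex.ofReal_mul, Finset.mul_sum]
      refine Finset.sum_congr rfl fun i _ => by ring
    rw [this]
    simpa using (Complex.ofRealCLM.hasDerivAt (x := (0 : ℝ))).mul_const
      (Complex.I * ∑ i, (n i : ℂ) * (v i : ℂ))
  have h4 := h3.cexp.mul_const (∫ t, mFourier (-n) t * f (scale t) ∂unitHaar d)
  simpa using h4

open UnitAddTorus in
theorem mFourierCoeff_laplacian {f : FlatTorus d → ℂ} (hf : Smooth f) (n : Fin d → ℤ) :
    ∫ t, mFourier (-n) t * laplacian f (scale t) ∂unitHaar d =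
      -(∑ i, (n i : ℂ) ^ 2) * ∫ t, mFourier (-n) t * f (scale t) ∂unitHaar d := by
  simp only [laplacian_eq_sum hf, Finset.mul_sum]
  rw [integral_finsetSum]
  · rw [neg_mul, Finset.sum_mul, ← Finset.sum_neg_distrib]
    refine Finset.sum_congr rfl fun i _ => ?_
    rw [mFourierCoeff_dirDeriv (hf.dirDeriv _), mFourierCoeff_dirDeriv hf]
    have : ∑ j, (n j : ℂ) * ((EuclideanSpace.single i (1 : ℝ) : EuclideanSpace ℝ (Fin d)) j : ℂ)
        = n i := by
      rw [Finset.sum_eq_single i] <;> simp +contextual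
    rw [this]
    linear_combination (n i : ℂ) ^ 2 * (∫ t, mFourier (-n) t * f (scale t) ∂unitHaar d) * Complex.I_sq
  · intro i _
    exact ((mFourier (-n)).continuous.mul
      (((hf.dirDeriv _).dirDeriv _).continuous.comp continuous_scale)
      ).integrable_of_hasCompactSupport (HasCompactSupport.of_compactSpace _)

/-- The integer points `n ∈ ℤᵈ` with `|n|² = k`. -/
def latticeSphere (d k : ℕ) : Set (Fin d → ℤ) := {n | ∑ i, n i ^ 2 = (k : ℤ)}

theorem finite_latticeSphere (d k : ℕ) : (latticeSphere d k).Finite := by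
  refine (Set.finite_Icc (fun _ : Fin d => -(k : ℤ)) (fun _ => (k : ℤ))).subset fun n hn => ?_
  have h : ∀ i, |n i| ≤ k := fun i => by
    have h1 : n i ^ 2 ≤ k := by
      rw [← show ∑ i, n i ^ 2 = (k : ℤ) from hn]
      exact Finset.single_le_sum (f := fun i => n i ^ 2) (fun j _ => sq_nonneg _)
        (Finset.mem_univ i)
    refine le_trans ?_ h1
    rw [← sq_abs]
    rcases (abs_nonneg (n i)).eq_or_lt with h0 | h0
    · rw [← h0]; simp
    · nlinarith
  exact ⟨fun i => (abs_le.1 (h i)).1, fun i => (abs_le.1 (h i)).2⟩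

open UnitAddTorus in
theorem eq_zero_of_mFourierCoeff {k : ℕ} {f : FlatTorus d → ℂ} (hf : Smooth f)
    (hk : ∀ x, -laplacian f x = (k : ℂ) * f x)
    (h0 : ∀ n ∈ latticeSphere d k, ∫ t, mFourier (-n) t * f (scale t) ∂unitHaar d = 0) : f = 0 := by
  let g : C(UnitAddTorus (Fin d), ℂ) := ⟨fun t => f (scale t), hf.continuous.comp continuous_scale⟩
  have hg : mFourierCoeff g = 0 := by
    ext n
    rw [Pi.zero_apply]
    change ∫ t, mFourier (-n) t * f (scale t) ∂unitHaar d = 0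
    by_cases hn : n ∈ latticeSphere d k
    · exact h0 n hn
    · have h1 := mFourierCoeff_laplacian hf n
      have h2 : ∀ x, laplacian f x = -(k : ℂ) * f x := fun x => by
        rw [neg_mul, ← hk x, neg_neg]
      simp only [h2, mul_left_comm _ (-(k : ℂ))] at h1
      rw [integral_const_mul] at h1
      have h3 : ((∑ i, (n i : ℂ) ^ 2) - k) * ∫ t, mFourier (-n) t * f (scale t) ∂unitHaar d = 0 := by
        linear_combination h1
      refine (mul_eq_zero.1 h3).resolve_left fun h4 => hn ?_
      have h5 : ((∑ i, n i ^ 2 : ℤ) : ℂ) = ((k : ℤ) : ℂ) := by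
        push_cast; linear_combination h4
      exact_mod_cast h5
  funext x
  obtain ⟨t, rfl⟩ := scale_surjective x
  have h6 := hasSum_mFourier_series_apply_of_summable (f := g) (by rw [hg]; exact summable_zero) t
  simp only [hg, Pi.zero_apply, zero_smul] at h6
  exact h6.unique hasSum_zero

/-- `f ↦ ∫ e_{-n} L(f)` as a linear form. -/
def coeffForm (L : 𝕂 →L[ℝ] ℂ) (n : Fin d → ℤ) : C(FlatTorus d, 𝕂) →ₗ[ℝ] ℂ where
  toFun f := ∫ t, UnitAddTorus.mFourier (-n) t * L (f (scale t)) ∂unitHaar d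
  map_add' f g := by
    have h : ∀ f : C(FlatTorus d, 𝕂), Integrable
        (fun t => UnitAddTorus.mFourier (-n) t * L (f (scale t))) (unitHaar d) := fun f =>
      ((UnitAddTorus.mFourier (-n)).continuous.mul
        (L.continuous.comp (f.continuous.comp continuous_scale))
        ).integrable_of_hasCompactSupport (HasCompactSupport.of_compactSpace _)
    rw [← integral_add (h f) (h g)]
    simp [mul_add]
  map_smul' c f := by
    rw [RingHom.id_apply, ← integral_smul]
    simp [mul_left_comm]

instance finiteDimensional_smoothEigenfunctions (k : ℕ) :
    FiniteDimensional ℝ (smoothEigenfunctions 𝕂 d k) := by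
  have : Finite (latticeSphere d k) := finite_latticeSphere d k
  let L₁ : 𝕂 →L[ℝ] ℂ := Complex.ofRealCLM.comp RCLike.reCLM
  let L₂ : 𝕂 →L[ℝ] ℂ := Complex.ofRealCLM.comp RCLike.imCLM
  let T : smoothEigenfunctions 𝕂 d k →ₗ[ℝ] (latticeSphere d k → ℂ × ℂ) :=
    (LinearMap.pi fun n => (coeffForm L₁ n.1).prod (coeffForm L₂ n.1)).comp
      ((smoothEigenfunctions 𝕂 d k).subtype.restrictScalars ℝ)
  refine FiniteDimensional.of_injective T (LinearMap.ker_eq_bot.1 ?_)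
  rw [LinearMap.ker_eq_bot']
  rintro ⟨f, hf, hfk⟩ hT
  have hL : ∀ L : 𝕂 →L[ℝ] ℂ, (∀ n ∈ latticeSphere d k, coeffForm L n f = 0) →
      (fun x => L (f x)) = 0 := by
    intro L h
    refine eq_zero_of_mFourierCoeff (hf.clm_comp L) (fun x => ?_) h
    rw [laplacian_clm_comp hf, ← map_neg, hfk]
    have : (k : 𝕂) * f x = (k : ℝ) • f x := by rw [RCLike.real_smul_eq_coe_mul]; simp
    rw [this, map_smul, Complex.real_smul]
    simp
  have h1 := hL L₁ fun n hn => congrArg Prod.fst (congrFun hT ⟨n, hn⟩)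
  have h2 := hL L₂ fun n hn => congrArg Prod.snd (congrFun hT ⟨n, hn⟩)
  ext x
  refine RCLike.ext ?_ ?_
  · have := congrFun h1 x
    simpa [L₁] using this
  · have := congrFun h2 x
    simpa [L₂] using this

/-- The eigenspace of `-Δ` on `L²(𝕋ᵈ)` for the eigenvalue `k`, with the `L²` norm. -/
def eigenspace (𝕂 : Type*) [RCLike 𝕂] (d k : ℕ) :
    Submodule 𝕂 (Lp 𝕂 2 (volume : Measure (FlatTorus d))) :=
  (smoothEigenfunctions 𝕂 d k).map (ContinuousMap.toLp 2 volume 𝕂).toLinearMap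

instance finiteDimensional_eigenspace (k : ℕ) : FiniteDimensional ℝ (eigenspace 𝕂 d k) :=
  Module.Finite.of_surjective
    (((ContinuousMap.toLp (E := 𝕂) 2 (volume : Measure (FlatTorus d)) 𝕂).toLinearMap.submoduleMap
      (smoothEigenfunctions 𝕂 d k)).restrictScalars ℝ)
    (LinearMap.submoduleMap_surjective _ _)

instance measurableSpace_eigenspace (k : ℕ) : MeasurableSpace (eigenspace 𝕂 d k) := borel _

instance borelSpace_eigenspace (k : ℕ) : BorelSpace (eigenspace 𝕂 d k) := ⟨rfl⟩

/-- The spectrum of `-Δ` on the torus: the `k ∈ ℕ` whose eigenspace has dimension at least `1`. -/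
def spectrum (𝕂 : Type*) [RCLike 𝕂] (d : ℕ) : Set ℕ :=
  {k | 1 ≤ Module.finrank 𝕂 (eigenspace 𝕂 d k)}

instance nontrivial_eigenspace (k : spectrum 𝕂 d) : Nontrivial (eigenspace 𝕂 d k) :=
  Module.nontrivial_of_finrank_pos (R := 𝕂) k.2

end
end FlatTorus

/-- The uniform probability measure on the unit sphere of a (real or complex) Euclidean space `E`:
the normalized surface measure. -/
def uniformOnSphere (E : Type*) [NormedAddCommGroup E] [NormedSpace ℝ E] [FiniteDimensional ℝ E]
    [MeasurableSpace E] [BorelSpace E] : Measure (sphere (0 : E) 1) :=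
  have : ProperSpace E := FiniteDimensional.proper ℝ E
  ((Measure.addHaar : Measure E).toSphere univ)⁻¹ • (Measure.addHaar : Measure E).toSphere

instance isProbabilityMeasure_uniformOnSphere (E : Type*) [NormedAddCommGroup E] [NormedSpace ℝ E]
    [FiniteDimensional ℝ E] [MeasurableSpace E] [BorelSpace E] [Nontrivial E] :
    IsProbabilityMeasure (uniformOnSphere E) := by
  have : ProperSpace E := FiniteDimensional.proper ℝ E
  refine ⟨ENNReal.inv_mul_cancel ?_ (measure_ne_top _ _)⟩
  exact (Measure.measure_univ_ne_zero).2 (Measure.toSphere_ne_zero _)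

namespace FlatTorus

/-- The sequences `(u_k)`, `k` in the spectrum, of unit vectors `u_k` of the eigenspaces. -/
abbrev UnitSequence (𝕂 : Type*) [RCLike 𝕂] (d : ℕ) : Type _ :=
  (k : spectrum 𝕂 d) → sphere (0 : eigenspace 𝕂 d k) 1

/-- The law of a sequence of independent uniform unit vectors of the eigenspaces. -/
def unitSequenceLaw (𝕂 : Type*) [RCLike 𝕂] (d : ℕ) : Measure (UnitSequence 𝕂 d) :=
  Measure.infinitePi fun k : spectrum 𝕂 d => uniformOnSphere (eigenspace 𝕂 d k)

instance isProbabilityMeasure_unitSequenceLaw (𝕂 : Type*) [RCLike 𝕂] (d : ℕ) :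
    IsProbabilityMeasure (unitSequenceLaw 𝕂 d) := by
  unfold unitSequenceLaw; infer_instance

end FlatTorus

end

/-! Fix `C` and let `n` be the real dimension of an eigenspace, `V` the volume of the torus. For an
orthonormal basis `b i` of the eigenspace, the function `x ↦ ∑ ‖b i x‖ ^ 2` has integral `n`, so it
is at least `n / V` at some point `x`. The real or the imaginary part of evaluation at `x` is then a
linear form of norm at least `√(n / (2 V))`. A vector bounded by `C` therefore satisfies `⟨e, u⟩ ≤ C
√(2 V) / √n` for a suitable unit vector `e` (`exists_unit_inner_le`).

The opposite cap, at height `c / √n`, has probability at least some `δ > 0` depending only on `c`,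
once `n` is large (`uniformOnSphere_cap_ge`). So the bound `C` holds on such an eigenspace with
probability at most `1 - δ`.

Since `d ≥ 2`, there are infinitely many such eigenspaces: some circles centred at the origin carry
as many integer points as desired, and these give independent standing waves
(`infinite_setOf_le_finrank_eigenspace`). By independence the bound `C` holds for all `k` with
probability at most `(1 - δ) ^ T` for every `T`, hence with probability zero. A countable union over
integer bounds concludes. -/

open scoped Pointwise

noncomputable section

/-! ### Spherical caps of mass independent of the dimension -/

section SphericalCap

/-- Translating by `s • e` raises the height to at least `s` and keeps the norm below 1, as `‖s • e
+ y‖ ^ 2 < s ^ 2 + 2 * s ^ 2 + r ^ 2`. Normalizing a vector of norm less than 1 raises its height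
strictly above `s`. This bounds the cone over a cap from below by a piece of a ball. -/
theorem half_slab_subset_cone {E : Type*} [NormedAddCommGroup E] [InnerProductSpace ℝ E]
    {r s : ℝ} {e : E} (he : ‖e‖ = 1) (hr0 : 0 ≤ r) (hs0 : 0 < s)
    (hrs : 3 * s ^ 2 + r ^ 2 ≤ 1) :
    (fun y => s • e + y) '' (ball 0 r ∩ {y | 0 ≤ inner ℝ e y ∧ inner ℝ e y < s}) ⊆
      Ioo (0 : ℝ) 1 • (Subtype.val '' {w : sphere (0 : E) 1 | s < inner ℝ e (w : E)}) := by
  rintro _ ⟨y, ⟨hy, h0, h1⟩, rfl⟩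
  have hyr : ‖y‖ < r := by simpa using hy
  set x := s • e + y with hx
  have hex : s ≤ inner ℝ e x := by
    rw [hx, inner_add_right, inner_smul_right, real_inner_self_eq_norm_sq, he]; linarith
  have hx1 : ‖x‖ ^ 2 < 1 := by
    rw [hx, norm_add_sq_real, norm_smul, he, inner_smul_left]
    simp only [Real.norm_eq_abs, mul_one, sq_abs, conj_trivial]
    nlinarith [norm_nonneg y]
  have hxlt : ‖x‖ < 1 := by nlinarith [norm_nonneg x]
  have hx0 : x ≠ 0 := by
    intro h; rw [h, inner_zero_right] at hex; linarith
  have hxp : 0 < ‖x‖ := norm_pos_iff.2 hx0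
  refine Set.mem_smul.2 ⟨‖x‖, ⟨hxp, hxlt⟩, ‖x‖⁻¹ • x, ⟨⟨‖x‖⁻¹ • x, ?_⟩, ?_, rfl⟩, ?_⟩
  · simp [norm_smul, hxp.ne']
  · change s < inner ℝ e (‖x‖⁻¹ • x)
    rw [inner_smul_right, ← div_eq_inv_mul, lt_div_iff₀ hxp]
    nlinarith
  · rw [smul_smul, mul_inv_cancel₀ hxp.ne', one_smul]

theorem exp_neg_two_mul_le_one_sub {x : ℝ} (h0 : 0 ≤ x) (h : x ≤ 1 / 2) :
    Real.exp (-(2 * x)) ≤ 1 - x := by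
  rw [Real.exp_neg, inv_le_comm₀ (Real.exp_pos _) (by linarith)]
  refine le_trans ?_ (Real.add_one_le_exp (2 * x))
  rw [inv_le_iff_one_le_mul₀ (by linarith)]
  nlinarith

variable {E : Type*} [NormedAddCommGroup E] [InnerProductSpace ℝ E] [FiniteDimensional ℝ E]
  [MeasurableSpace E] [BorelSpace E]

theorem LinearIsometryEquiv.measurePreserving_addHaar (μ : Measure E) [μ.IsAddHaarMeasure]
    (R : E ≃ₗᵢ[ℝ] E) : MeasurePreserving R μ μ := by
  rw [Measure.isAddLeftInvariant_eq_smul μ volume]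
  exact R.measurePreserving.smul_measure _

/-- The reflection exchanging `e` and `f` preserves both the ball and the measure. -/
theorem lintegral_ball_inner_sq_eq (μ : Measure E) [μ.IsAddHaarMeasure] (r : ℝ) {e f : E}
    (hef : ‖e‖ = ‖f‖) :
    ∫⁻ y in ball 0 r, ENNReal.ofReal (inner ℝ e y ^ 2) ∂μ =
      ∫⁻ y in ball 0 r, ENNReal.ofReal (inner ℝ f y ^ 2) ∂μ := by
  let R := (Submodule.span ℝ {e - f})ᗮ.reflection
  have hR : R e = f := Submodule.reflection_sub hef
  have h := (R.measurePreserving_addHaar μ).setLIntegral_comp_preimage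
    (s := ball 0 r) measurableSet_ball (f := fun y => ENNReal.ofReal (inner ℝ f y ^ 2))
    (by fun_prop)
  rw [← h]
  have hb : R ⁻¹' ball 0 r = ball 0 r := by ext y; simp
  rw [hb]
  refine lintegral_congr fun y => ?_
  rw [← hR, R.inner_map_map]

/-- All directions have the same second moment, and over an orthonormal basis these moments add up
to the integral of `‖y‖ ^ 2`. -/
theorem finrank_mul_lintegral_ball_inner_sq_le (μ : Measure E) [μ.IsAddHaarMeasure] {r : ℝ}
    {e : E} (he : ‖e‖ = 1) :
    Module.finrank ℝ E * ∫⁻ y in ball 0 r, ENNReal.ofReal (inner ℝ e y ^ 2) ∂μ ≤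
      ENNReal.ofReal (r ^ 2) * μ (ball 0 r) := by
  let b := stdOrthonormalBasis ℝ E
  have h1 : ∑ i, ∫⁻ y in ball 0 r, ENNReal.ofReal (inner ℝ (b i) y ^ 2) ∂μ =
      Module.finrank ℝ E * ∫⁻ y in ball 0 r, ENNReal.ofReal (inner ℝ e y ^ 2) ∂μ := by
    rw [Finset.sum_congr rfl fun i _ => lintegral_ball_inner_sq_eq μ r (e := b i) (f := e)
      (by rw [he, b.orthonormal.1 i])]
    simp
  rw [← h1, ← lintegral_finsetSum _ (fun i _ => by fun_prop), ← setLIntegral_const]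
  refine setLIntegral_mono measurable_const fun y hy => ?_
  rw [← ENNReal.ofReal_sum_of_nonneg fun i _ => sq_nonneg _]
  refine ENNReal.ofReal_le_ofReal ?_
  have := b.sum_sq_norm_inner_right y
  simp only [Real.norm_eq_abs, sq_abs] at this
  rw [this]
  have : ‖y‖ < r := by simpa using hy
  exact pow_le_pow_left₀ (norm_nonneg _) this.le 2

/-- Chebyshev's inequality in a ball: most of its mass lies at distance `O(1 / √dim E)` from a
hyperplane through its centre. -/
theorem measure_ball_inner_abs_ge_le (μ : Measure E) [μ.IsAddHaarMeasure] {r s : ℝ} {e : E}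
    (he : ‖e‖ = 1) (hr0 : 0 ≤ r) (hr : r ≤ 1) (hs0 : 0 < s)
    (hs : 4 ≤ Module.finrank ℝ E * s ^ 2) :
    4 * μ (ball 0 r ∩ {y | s ≤ |inner ℝ e y|}) ≤ μ (ball 0 r) := by
  have hM := mul_meas_ge_le_lintegral₀ (μ := μ.restrict (ball 0 r))
    (f := fun y => ENNReal.ofReal (inner ℝ e y ^ 2)) (by fun_prop) (ENNReal.ofReal (s ^ 2))
  rw [Measure.restrict_apply' measurableSet_ball] at hM
  have hsub : ball 0 r ∩ {y | s ≤ |inner ℝ e y|} ⊆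
      {y | ENNReal.ofReal (s ^ 2) ≤ ENNReal.ofReal (inner ℝ e y ^ 2)} ∩ ball 0 r := by
    rintro y ⟨hy, hy'⟩
    refine ⟨ENNReal.ofReal_le_ofReal ?_, hy⟩
    rw [← sq_abs (inner ℝ e y)]
    exact pow_le_pow_left₀ hs0.le hy' 2
  calc 4 * μ (ball 0 r ∩ {y | s ≤ |inner ℝ e y|})
      ≤ ENNReal.ofReal (Module.finrank ℝ E * s ^ 2) *
        μ ({y | ENNReal.ofReal (s ^ 2) ≤ ENNReal.ofReal (inner ℝ e y ^ 2)} ∩ ball 0 r) := by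
        gcongr
        simpa using ENNReal.ofReal_le_ofReal hs
    _ = Module.finrank ℝ E * (ENNReal.ofReal (s ^ 2) *
        μ ({y | ENNReal.ofReal (s ^ 2) ≤ ENNReal.ofReal (inner ℝ e y ^ 2)} ∩ ball 0 r)) := by
        rw [ENNReal.ofReal_mul (by positivity), ENNReal.ofReal_natCast, mul_assoc]
    _ ≤ Module.finrank ℝ E * ∫⁻ y in ball 0 r, ENNReal.ofReal (inner ℝ e y ^ 2) ∂μ := by gcongr
    _ ≤ ENNReal.ofReal (r ^ 2) * μ (ball 0 r) := finrank_mul_lintegral_ball_inner_sq_le μ he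
    _ ≤ 1 * μ (ball 0 r) := by
        gcongr
        exact ENNReal.ofReal_le_one.2 (pow_le_one₀ hr0 hr)
    _ = μ (ball 0 r) := one_mul _

/-- The slab `|⟨e, y⟩| < s` holds at least 3/4 of the ball by Chebyshev, and `y ↦ -y` exchanges its
two halves. -/
theorem measure_ball_le_half_slab (μ : Measure E) [μ.IsAddHaarMeasure] {r s : ℝ} {e : E}
    (he : ‖e‖ = 1) (hr0 : 0 ≤ r) (hr : r ≤ 1) (hs0 : 0 < s)
    (hs : 4 ≤ Module.finrank ℝ E * s ^ 2) :
    3 * μ (ball 0 r) ≤ 8 * μ (ball 0 r ∩ {y | 0 ≤ inner ℝ e y ∧ inner ℝ e y < s}) := by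
  set A := ball (0 : E) r ∩ {y | 0 ≤ inner ℝ e y ∧ inner ℝ e y < s}
  have hA : μ (-A) = μ A := Measure.measure_neg μ A
  have hcov : ball (0 : E) r ⊆ (A ∪ -A) ∪ (ball 0 r ∩ {y | s ≤ |inner ℝ e y|}) := by
    intro y hy
    by_cases h : s ≤ |inner ℝ e y|
    · exact Or.inr ⟨hy, h⟩
    · left
      rw [not_le, abs_lt] at h
      rcases le_total 0 (inner ℝ e y) with h0 | h0
      · exact Or.inl ⟨hy, h0, h.2⟩
      · refine Or.inr ⟨by simpa using hy, ?_, ?_⟩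
        · simpa using h0
        · simp only [inner_neg_right]; linarith
  have h1 : μ (ball 0 r) ≤ μ A + μ A + μ (ball 0 r ∩ {y | s ≤ |inner ℝ e y|}) := by
    refine (measure_mono hcov).trans ((measure_union_le _ _).trans ?_)
    gcongr
    exact (measure_union_le _ _).trans_eq (by rw [hA])
  have h2 := measure_ball_inner_abs_ge_le μ he hr0 hr hs0 hs
  have hfin : μ (ball 0 r) ≠ ⊤ := measure_ball_lt_top.ne
  have hAf : μ A ≠ ⊤ := ne_top_of_le_ne_top hfin (measure_mono inter_subset_left)
  have hBf : μ (ball 0 r ∩ {y | s ≤ |inner ℝ e y|}) ≠ ⊤ :=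
    ne_top_of_le_ne_top hfin (measure_mono inter_subset_left)
  generalize μ (ball 0 r ∩ {y | s ≤ |inner ℝ e y|}) = b at *
  generalize μ A = a at *
  generalize μ (ball 0 r) = t at *
  lift a to NNReal using hAf
  lift b to NNReal using hBf
  lift t to NNReal using hfin
  norm_cast at *
  rw [← NNReal.coe_le_coe] at *
  push_cast at *
  linarith

/-- A spherical cap at height `c / √dim E` has a mass bounded below independently of the
dimension. -/
theorem uniformOnSphere_cap_ge {c : ℝ} (hc : 2 ≤ c) (hn : 6 * c ^ 2 ≤ Module.finrank ℝ E)
    {e : E} (he : ‖e‖ = 1) :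
    ENNReal.ofReal (3 / 8 * Real.exp (-(6 * c ^ 2))) ≤
      uniformOnSphere E {w | c / √(Module.finrank ℝ E) < inner ℝ e (w : E)} := by
  set n := Module.finrank ℝ E with hn'
  have hn0 : (0 : ℝ) < n := by nlinarith
  have : Nontrivial E := Module.nontrivial_of_finrank_pos (R := ℝ) (by exact_mod_cast hn0)
  set s := c / √n with hs
  -- As `0 ≤ r ≤ 1`, `r ^ 2 ≤ r`, whence `3 * s ^ 2 + r ^ 2 ≤ 1`. This radius also makes `r ^ n`
  -- bounded below, because `n * s ^ 2 = c ^ 2`.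
  set r := 1 - 3 * s ^ 2 with hr
  have hs0 : 0 < s := div_pos (by linarith) (Real.sqrt_pos.2 hn0)
  have hs2 : s ^ 2 = c ^ 2 / n := by rw [hs, div_pow, Real.sq_sqrt hn0.le]
  have hns : n * s ^ 2 = c ^ 2 := by rw [hs2]; field_simp
  have hs6 : 6 * s ^ 2 ≤ 1 := by
    rw [hs2, ← mul_div_assoc, div_le_one hn0]; exact hn
  have hr0 : 0 ≤ r := by linarith
  have hr1 : r ≤ 1 := by nlinarith
  set μ : Measure E := Measure.addHaar
  set K := {w : sphere (0 : E) 1 | s < inner ℝ e (w : E)}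
  have hK : MeasurableSet K := by
    have : Continuous fun w : sphere (0 : E) 1 => (inner ℝ e (w : E) : ℝ) := by fun_prop
    exact measurableSet_lt measurable_const this.measurable
  have h1 : 3 * μ (ball 0 r) ≤ 8 * μ (Ioo (0 : ℝ) 1 • (Subtype.val '' K)) := by
    refine (measure_ball_le_half_slab μ he hr0 hr1 hs0 (by rw [hns]; nlinarith)).trans (mul_le_mul' le_rfl ?_)
    have hsub := half_slab_subset_cone he hr0 hs0 (by nlinarith)
    refine le_trans (le_of_eq ?_) (measure_mono (μ := μ) hsub)
    rw [image_add_left, measure_preimage_add]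
  have h2 : ENNReal.ofReal (Real.exp (-(6 * c ^ 2))) * μ (ball 0 1) ≤ μ (ball 0 r) := by
    have := Measure.addHaar_ball_mul μ (0 : E) hr0 1
    rw [mul_one] at this
    rw [this]
    gcongr
    have : Real.exp (-(6 * c ^ 2)) = Real.exp (-(2 * (3 * s ^ 2))) ^ n := by
      rw [← Real.exp_nat_mul]; congr 1; linear_combination 6 * hns
    rw [this]
    exact pow_le_pow_left₀ (Real.exp_pos _).le
      (exp_neg_two_mul_le_one_sub (by positivity) (by linarith)) _
  -- The surface measure is `n` times the volume of the cone; the factor `n` cancels in the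
  -- quotient.
  rw [uniformOnSphere, Measure.smul_apply, smul_eq_mul, Measure.toSphere_apply_univ,
    Measure.toSphere_apply' _ hK, ← ENNReal.div_eq_inv_mul]
  have hb0 : μ (ball 0 1) ≠ 0 := (measure_ball_pos μ 0 one_pos).ne'
  have hbt : μ (ball 0 1) ≠ ⊤ := measure_ball_lt_top.ne
  have hnE0 : (n : ENNReal) ≠ 0 := by
    have : n ≠ 0 := by rintro h; simp [h] at hn0
    exact_mod_cast this
  rw [ENNReal.mul_div_mul_left _ _ hnE0 (ENNReal.natCast_ne_top n),
    ENNReal.le_div_iff_mul_le (Or.inl hb0) (Or.inl hbt)]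
  rw [ENNReal.ofReal_mul (by norm_num), mul_assoc]
  have h38 : ENNReal.ofReal (3 / 8) = 3 / 8 := by
    rw [ENNReal.ofReal_div_of_pos (by norm_num)]; simp
  rw [h38]
  calc (3 / 8 : ENNReal) * (ENNReal.ofReal (Real.exp (-(6 * c ^ 2))) * μ (ball 0 1))
      ≤ 3 / 8 * μ (ball 0 r) := by gcongr
    _ = (3 * μ (ball 0 r)) / 8 := by rw [ENNReal.mul_div_right_comm]
    _ ≤ _ := ENNReal.div_le_of_le_mul' h1

end SphericalCap

/-! ### Integer points on circles -/

/-- There are arbitrarily many integer points with distinct nonnegative abscissae on infinitely many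
circles. -/
theorem exists_many_lattice_points (M : ℕ) :
    ∃ D : ℕ, 0 < D ∧ ∀ m : ℕ, 0 < m → ∃ a b : Fin M → ℕ, Function.Injective a ∧
      ∀ j, a j ^ 2 + b j ^ 2 = (m * D) ^ 2 := by
  -- The rational points `((t² - 1) / (t² + 1), 2t / (t² + 1))` of the unit circle, for `t = 1, …,
  -- M`; `D` is a common denominator.
  let t : Fin M → ℕ := fun j => (j : ℕ) + 1
  let D := ∏ j, (t j ^ 2 + 1)
  let q : Fin M → ℕ := fun j => ∏ i ∈ Finset.univ.erase j, (t i ^ 2 + 1)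
  have hq : ∀ j, (t j ^ 2 + 1) * q j = D := fun j =>
    Finset.mul_prod_erase Finset.univ (fun i => t i ^ 2 + 1) (Finset.mem_univ j)
  have hq0 : ∀ j, 0 < q j := fun j => Finset.prod_pos fun i _ => by positivity
  refine ⟨D, Finset.prod_pos fun i _ => by positivity, fun m hm => ?_⟩
  -- The difference is `t² - 1`, and the natural subtraction is exact because `t ≥ 1`.
  refine ⟨fun j => m * (q j * (2 * t j ^ 2 - (t j ^ 2 + 1))), fun j => m * (q j * (2 * t j)),
    ?_, fun j => ?_⟩
  all_goals
    have ht : ∀ j, t j ^ 2 + 1 ≤ 2 * t j ^ 2 := fun j => by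
      have : 1 ≤ t j ^ 2 := Nat.one_le_pow _ _ (Nat.succ_pos _)
      omega
  · intro i j hij
    have h1 : q i * (2 * t i ^ 2 - (t i ^ 2 + 1)) = q j * (2 * t j ^ 2 - (t j ^ 2 + 1)) :=
      Nat.eq_of_mul_eq_mul_left hm hij
    have hi := hq i
    have hj := hq j
    -- Subtracting `q (t² - 1)`, common to `i` and `j`, from `q (t² + 1) = D` leaves `2 q`.
    have h2 : q i = q j := by
      zify [ht i, ht j] at h1 hi hj ⊢
      linarith
    have h3 : t i ^ 2 = t j ^ 2 := by
      rw [← hj, h2] at hi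
      have := Nat.eq_of_mul_eq_mul_right (hq0 j) hi
      omega
    have h4 : t i = t j := Nat.pow_left_injective two_ne_zero h3
    exact Fin.ext (by simpa [t] using h4)
  · rw [← hq j]
    zify [ht j]
    ring

/-! ### Standing waves and the dimension of the eigenspaces -/

namespace FlatTorus

variable {𝕂 : Type*} [RCLike 𝕂] {d : ℕ}

/-- The identification of the circle of length `2π` with the angles. -/
def toAngle : AddCircle (2 * Real.pi) →+ Real.Angle := AddMonoidHom.id _

/-- The phase `n · x` of the plane wave of frequency `n`. -/
def phase (n : Fin d → ℤ) (x : FlatTorus d) : Real.Angle := ∑ i, n i • toAngle (x i)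

theorem phase_add (n : Fin d → ℤ) (x y : FlatTorus d) : phase n (x + y) = phase n x + phase n y := by
  simp only [phase, Pi.add_apply, map_add, smul_add, Finset.sum_add_distrib]

theorem phase_proj (n : Fin d → ℤ) (y : EuclideanSpace ℝ (Fin d)) :
    phase n (proj y) = ((∑ i, n i * y i : ℝ) : Real.Angle) := by
  change _ = Real.Angle.coeHom _
  rw [phase, map_sum]
  refine Finset.sum_congr rfl fun i _ => ?_
  rw [← zsmul_eq_mul, map_zsmul]
  rfl

theorem continuous_phase (n : Fin d → ℤ) : Continuous (phase n) := by
  refine continuous_finsetSum _ fun i _ => ?_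
  have h : Continuous toAngle := continuous_id
  exact (h.comp (continuous_apply i)).zsmul (n i)

/-- The standing wave `x ↦ cos (n · x)`. -/
def cosWave (𝕂 : Type*) [RCLike 𝕂] (n : Fin d → ℤ) : C(FlatTorus d, 𝕂) where
  toFun x := ((Real.Angle.cos (phase n x) : ℝ) : 𝕂)
  continuous_toFun :=
    RCLike.continuous_ofReal.comp (Real.Angle.continuous_cos.comp (continuous_phase n))

theorem exists_phase_add_proj (n : Fin d → ℤ) (x : FlatTorus d) :
    ∃ θ : ℝ, ∀ y, phase n (x + proj y) = ((θ + ∑ i, n i * y i : ℝ) : Real.Angle) := by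
  obtain ⟨z, rfl⟩ := isOpenQuotientMap_proj.surjective x
  refine ⟨∑ i, n i * z i, fun y => ?_⟩
  rw [phase_add, phase_proj, phase_proj, Real.Angle.coe_add]

theorem hasFDerivAt_dot (n : Fin d → ℤ) (θ : ℝ) (y : EuclideanSpace ℝ (Fin d)) :
    HasFDerivAt (fun y : EuclideanSpace ℝ (Fin d) => θ + ∑ i, n i * y i)
      (∑ i, (n i : ℝ) • (EuclideanSpace.proj i : EuclideanSpace ℝ (Fin d) →L[ℝ] ℝ)) y := by
  refine HasFDerivAt.const_add _ (HasFDerivAt.fun_sum fun i _ => ?_)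
  exact (EuclideanSpace.proj (𝕜 := ℝ) i).hasFDerivAt.const_mul (n i : ℝ)

theorem dirDeriv_cos_phase (n : Fin d → ℤ) (v : EuclideanSpace ℝ (Fin d)) :
    dirDeriv v (fun x => Real.Angle.cos (phase n x)) =
      fun x => -(∑ i, n i * v i) * Real.Angle.sin (phase n x) := by
  funext x
  obtain ⟨θ, hθ⟩ := exists_phase_add_proj n x
  have h0 := hθ 0
  simp only [proj_zero, add_zero, PiLp.zero_apply, mul_zero, Finset.sum_const_zero] at h0
  simp only [dirDeriv, hθ, Real.Angle.cos_coe]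
  rw [(hasFDerivAt_dot n θ 0).cos.fderiv, h0, Real.Angle.sin_coe]
  simp
  ring

theorem dirDeriv_sin_phase (n : Fin d → ℤ) (v : EuclideanSpace ℝ (Fin d)) (c : ℝ) :
    dirDeriv v (fun x => c * Real.Angle.sin (phase n x)) =
      fun x => c * (∑ i, n i * v i) * Real.Angle.cos (phase n x) := by
  funext x
  obtain ⟨θ, hθ⟩ := exists_phase_add_proj n x
  have h0 := hθ 0
  simp only [proj_zero, add_zero, PiLp.zero_apply, mul_zero, Finset.sum_const_zero] at h0
  simp only [dirDeriv, hθ, Real.Angle.sin_coe]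
  rw [((hasFDerivAt_dot n θ 0).sin.const_mul c).fderiv, h0, Real.Angle.cos_coe]
  simp
  ring

theorem smooth_cos_phase (n : Fin d → ℤ) : Smooth fun x => Real.Angle.cos (phase n x) := by
  simp only [Smooth, phase_proj, Real.Angle.cos_coe]
  fun_prop

theorem laplacian_cos_phase (n : Fin d → ℤ) (x : FlatTorus d) :
    laplacian (fun x => Real.Angle.cos (phase n x)) x =
      -(∑ i, (n i : ℝ) ^ 2) * Real.Angle.cos (phase n x) := by
  rw [laplacian_eq_sum (smooth_cos_phase n), neg_mul, Finset.sum_mul, ← Finset.sum_neg_distrib]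
  refine Finset.sum_congr rfl fun i _ => ?_
  rw [dirDeriv_cos_phase, dirDeriv_sin_phase]
  have : ∑ j, (n j : ℝ) * ((EuclideanSpace.single i (1 : ℝ) : EuclideanSpace ℝ (Fin d)) j)
      = n i := by
    rw [Finset.sum_eq_single i] <;> simp +contextual
  rw [this]
  ring

theorem cosWave_mem {k : ℕ} {n : Fin d → ℤ} (hn : n ∈ latticeSphere d k) :
    cosWave 𝕂 n ∈ smoothEigenfunctions 𝕂 d k := by
  refine ⟨(smooth_cos_phase n).clm_comp (RCLike.ofRealCLM (K := 𝕂)), fun x => ?_⟩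
  have h := laplacian_clm_comp (smooth_cos_phase n) (RCLike.ofRealCLM (K := 𝕂)) x
  rw [laplacian_cos_phase] at h
  change -laplacian (fun x => RCLike.ofRealCLM (K := 𝕂) (Real.Angle.cos (phase n x))) x = _
  rw [h]
  have h1 : ∑ i, (n i : ℝ) ^ 2 = k := by
    have : ∑ i, n i ^ 2 = (k : ℤ) := hn
    exact_mod_cast this
  rw [h1]
  simp [cosWave]

/-- The operator `f ↦ f(· + h) + f(· - h)`. -/
def shiftSum (h : FlatTorus d) : Module.End ℝ (FlatTorus d → 𝕂) where
  toFun f x := f (x + h) + f (x - h)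
  map_add' f g := by ext x; simp only [Pi.add_apply]; ring
  map_smul' c f := by ext x; simp [smul_add]

theorem shiftSum_cosWave (n : Fin d → ℤ) (y : EuclideanSpace ℝ (Fin d)) :
    shiftSum (proj y) (cosWave 𝕂 n : FlatTorus d → 𝕂) =
      (2 * Real.cos (∑ i, n i * y i)) • (cosWave 𝕂 n : FlatTorus d → 𝕂) := by
  funext x
  obtain ⟨θ, hθ⟩ := exists_phase_add_proj n x
  have h0 := hθ 0
  simp only [proj_zero, add_zero, PiLp.zero_apply, mul_zero, Finset.sum_const_zero] at h0
  have hneg : x - proj y = x + proj (-y) := by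
    rw [sub_eq_add_neg]; congr 1
  simp only [shiftSum, LinearMap.coe_mk, AddHom.coe_mk, hneg, cosWave, ContinuousMap.coe_mk, hθ,
    Pi.smul_apply, h0, Real.Angle.cos_coe, RCLike.real_smul_eq_coe_mul]
  rw [← RCLike.ofReal_add, ← RCLike.ofReal_mul]
  congr 1
  simp only [PiLp.neg_apply, mul_neg, Finset.sum_neg_distrib, Real.cos_add, Real.cos_neg,
    Real.sin_neg]
  ring

/-- The waves are eigenvectors of one operator `shiftSum h` with distinct eigenvalues `2 cos (n ·
h)`. The shift `h` is taken along the axis `i₀` and so short that all the angles `n · h` lie in `[0,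
π]`, where the cosine is injective; hence the sign condition on the coordinates. -/
theorem linearIndependent_cosWave {ι : Type*} [Finite ι] (n : ι → Fin d → ℤ) (i₀ : Fin d)
    (hpos : ∀ j, 0 ≤ n j i₀) (hinj : Function.Injective fun j => n j i₀) :
    LinearIndependent ℝ fun j => cosWave 𝕂 (n j) := by
  obtain ⟨A, hA⟩ := (Set.finite_range fun j => n j i₀).bddAbove
  have hA' : ∀ j, n j i₀ ≤ max A 1 := fun j => (hA ⟨j, rfl⟩).trans (le_max_left _ _)
  have hA0 : (0 : ℝ) < (max A 1 : ℤ) := by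
    have : (0 : ℤ) < max A 1 := lt_max_of_lt_right one_pos
    exact_mod_cast this
  -- The maximum with 1 keeps `B` positive when all the abscissae vanish.
  set B : ℝ := ((max A 1 : ℤ) : ℝ)
  let y : EuclideanSpace ℝ (Fin d) := EuclideanSpace.single i₀ (Real.pi / B)
  have hy : ∀ j, ∑ i, (n j i : ℝ) * y i = n j i₀ * (Real.pi / B) := fun j => by
    rw [Finset.sum_eq_single i₀] <;> simp +contextual [y]
  have hev : ∀ j, (shiftSum (𝕂 := 𝕂) (proj y)).HasEigenvector
      (2 * Real.cos (n j i₀ * (Real.pi / B))) (cosWave 𝕂 (n j) : FlatTorus d → 𝕂) := fun j => by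
    refine ⟨Module.End.mem_eigenspace_iff.2 (by rw [shiftSum_cosWave, hy]), fun h => ?_⟩
    -- A standing wave equals 1 at the origin, so it is not zero.
    have := congrFun h (proj 0)
    simp [cosWave, phase_proj] at this
  have hmem : ∀ j, (n j i₀ : ℝ) * (Real.pi / B) ∈ Icc 0 Real.pi := fun j => by
    have h1 : (0 : ℝ) ≤ n j i₀ := by exact_mod_cast hpos j
    have h2 : (n j i₀ : ℝ) ≤ B := Int.cast_le.2 (hA' j)
    refine ⟨by positivity, ?_⟩
    rw [← mul_div_assoc, div_le_iff₀ hA0, mul_comm]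
    exact mul_le_mul_of_nonneg_left h2 Real.pi_pos.le
  have hli := Module.End.eigenvectors_linearIndependent' (shiftSum (𝕂 := 𝕂) (proj y))
    (fun j => 2 * Real.cos (n j i₀ * (Real.pi / B))) (fun i j hij => by
      have h1 := Real.injOn_cos (hmem i) (hmem j) (mul_left_cancel₀ two_ne_zero hij)
      have h2 := mul_right_cancel₀ (div_pos Real.pi_pos hA0).ne' h1
      exact hinj (by exact_mod_cast h2)) _ hev
  exact LinearIndependent.of_comp (M' := FlatTorus d → 𝕂)
    (ContinuousMap.coeFnLinearMap ℝ) hli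

/-- The continuous representative of an element of the eigenspace. -/
def repr (k : ℕ) : smoothEigenfunctions 𝕂 d k ≃ₗ[𝕂] eigenspace 𝕂 d k :=
  Submodule.equivMapOfInjective _ (ContinuousMap.toLp_injective volume) _

theorem le_finrank_eigenspace {M k : ℕ} (n : Fin M → Fin d → ℤ) (i₀ : Fin d)
    (hn : ∀ j, n j ∈ latticeSphere d k)
    (hpos : ∀ j, 0 ≤ n j i₀) (hinj : Function.Injective fun j => n j i₀) :
    M ≤ Module.finrank ℝ (eigenspace 𝕂 d k) := by
  have h1 : LinearIndependent ℝ fun j => (⟨cosWave 𝕂 (n j), cosWave_mem (hn j)⟩ :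
      smoothEigenfunctions 𝕂 d k) :=
    LinearIndependent.of_comp ((smoothEigenfunctions 𝕂 d k).subtype.restrictScalars ℝ)
      (linearIndependent_cosWave n i₀ hpos hinj)
  have h2 := h1.map' ((repr k).toLinearMap.restrictScalars ℝ)
    (LinearMap.ker_eq_bot.2 (repr k).injective)
  simpa using h2.fintype_card_le_finrank

theorem infinite_setOf_le_finrank_eigenspace (hd : 2 ≤ d) (M : ℕ) :
    {k | M ≤ Module.finrank ℝ (eigenspace 𝕂 d k)}.Infinite := by
  obtain ⟨D, hD, h⟩ := exists_many_lattice_points M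
  refine Set.infinite_of_injective_forall_mem (f := fun m : ℕ => ((m + 1) * D) ^ 2) ?_ fun m => ?_
  · intro m m' hm
    have h1 : (m + 1) * D = (m' + 1) * D := Nat.pow_left_injective two_ne_zero hm
    simpa using Nat.eq_of_mul_eq_mul_right hD h1
  · obtain ⟨a, b, ha, hab⟩ := h (m + 1) m.succ_pos
    obtain ⟨d, rfl⟩ := Nat.exists_eq_add_of_le' hd
    -- The planar points are completed by zeros in the remaining coordinates.
    refine le_finrank_eigenspace (fun j => Fin.cons (a j : ℤ) (Fin.cons (b j : ℤ) 0)) 0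
      (fun j => ?_) (fun j => ?_) fun i j hij => ?_
    · simp only [latticeSphere, mem_ofPred_eq, Fin.sum_univ_succ, Fin.cons_zero, Fin.cons_succ]
      simp only [← hab j]
      simp
    · simp
    · simp only [Fin.cons_zero] at hij
      exact ha (by exact_mod_cast hij)

end FlatTorus

/-! ### Evaluation at a point as a linear form on the eigenspace -/

/-- A nonzero linear form is its norm times the inner product with a unit vector. -/
theorem exists_unit_inner_mul_eq {E ι : Type*} [NormedAddCommGroup E] [InnerProductSpace ℝ E]
    [Fintype ι] (b : OrthonormalBasis ι ℝ E) (l : E →ₗ[ℝ] ℝ) (hl : 0 < ∑ i, l (b i) ^ 2) :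
    ∃ e : E, ‖e‖ = 1 ∧ ∀ u, inner ℝ e u * √(∑ i, l (b i) ^ 2) = l u := by
  have hf : ∀ u, inner ℝ (∑ i, l (b i) • b i) u = l u := fun u => by
    conv_rhs => rw [← b.sum_repr' u]
    simp only [sum_inner, inner_smul_left, map_sum, map_smul, smul_eq_mul, conj_trivial]
    exact Finset.sum_congr rfl fun i _ => mul_comm _ _
  set f := ∑ i, l (b i) • b i with hfdef
  have hff : ‖f‖ ^ 2 = ∑ i, l (b i) ^ 2 := by
    rw [← real_inner_self_eq_norm_sq, hf]
    simp only [hfdef, map_sum, map_smul, smul_eq_mul, sq]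
  have hf0 : ‖f‖ ≠ 0 := fun h => by simp [← hff, h] at hl
  refine ⟨‖f‖⁻¹ • f, by simp [norm_smul, hf0], fun u => ?_⟩
  rw [← hff, Real.sqrt_sq (norm_nonneg _), inner_smul_left, hf, conj_trivial]
  field_simp

namespace FlatTorus

variable {𝕂 : Type*} [RCLike 𝕂] {d : ℕ}

/-- The cap estimate lives in a real Euclidean space, so even for complex scalars the eigenspace
carries the real inner product, which induces the same `L²` norm. -/
instance innerProductSpaceReal_eigenspace (k : ℕ) : InnerProductSpace ℝ (eigenspace 𝕂 d k) where
  inner u v := inner ℝ (u : Lp 𝕂 2 (volume : Measure (FlatTorus d))) v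
  norm_sq_eq_re_inner u :=
    norm_sq_eq_re_inner (𝕜 := ℝ) (u : Lp 𝕂 2 (volume : Measure (FlatTorus d)))
  conj_inner_symm u v :=
    inner_conj_symm (𝕜 := ℝ) (u : Lp 𝕂 2 (volume : Measure (FlatTorus d))) v
  add_left u v w :=
    inner_add_left (𝕜 := ℝ) (u : Lp 𝕂 2 (volume : Measure (FlatTorus d))) v w
  smul_left u v r :=
    inner_smul_left (𝕜 := ℝ) (u : Lp 𝕂 2 (volume : Measure (FlatTorus d))) v r

/-- The value at `x` of the continuous representative of an element of the eigenspace. -/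
def eval (k : ℕ) (x : FlatTorus d) : eigenspace 𝕂 d k →ₗ[ℝ] 𝕂 where
  toFun u := ((repr k).symm u : C(FlatTorus d, 𝕂)) x
  map_add' u v := by simp
  map_smul' c u := by
    exact congrArg (fun f : smoothEigenfunctions 𝕂 d k => (f : C(FlatTorus d, 𝕂)) x)
      ((repr k).symm.toLinearMap.map_smul_of_tower c u)

theorem continuous_eval {k : ℕ} (u : eigenspace 𝕂 d k) : Continuous fun x => eval k x u :=
  ((repr k).symm u : C(FlatTorus d, 𝕂)).continuous

theorem coeFn_ae_eq_eval {k : ℕ} (u : eigenspace 𝕂 d k) :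
    ((u : Lp 𝕂 2 (volume : Measure (FlatTorus d))) : FlatTorus d → 𝕂) =ᵐ[volume]
      fun x => eval k x u := by
  obtain ⟨f, rfl⟩ := (repr k).surjective u
  have h := ContinuousMap.coeFn_toLp (p := 2) (𝕜 := 𝕂) (volume : Measure (FlatTorus d))
    (f : C(FlatTorus d, 𝕂))
  have he : ∀ x, eval k x (repr k f) = (f : C(FlatTorus d, 𝕂)) x := fun x => by simp [eval]
  simp only [he]
  exact h

/-- An almost everywhere bound holds everywhere for a continuous function, as nonempty open sets
have positive volume. It is applied to the equality of `max ‖eval k x u‖ C` with `C`. -/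
theorem norm_eval_le {k : ℕ} {u : eigenspace 𝕂 d k} {C : ℝ} (hC : 0 ≤ C)
    (h : eLpNorm (u : Lp 𝕂 2 (volume : Measure (FlatTorus d))) ⊤ volume ≤ ENNReal.ofReal C)
    (x : FlatTorus d) : ‖eval k x u‖ ≤ C := by
  rw [eLpNorm_exponent_top] at h
  have hae : (fun x => max ‖eval k x u‖ C) =ᵐ[volume] fun _ : FlatTorus d => C := by
    filter_upwards [coeFn_ae_eq_eval u, ae_le_eLpNormEssSup
      (f := ((u : Lp 𝕂 2 (volume : Measure (FlatTorus d))) : FlatTorus d → 𝕂))] with x hx hx'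
    rw [hx] at hx'
    have := hx'.trans h
    rw [← ofReal_norm, ENNReal.ofReal_le_ofReal_iff hC] at this
    exact max_eq_right this
  have := congrFun (Measure.eq_of_ae_eq hae
    ((continuous_eval u).norm.max continuous_const) continuous_const) x
  exact max_eq_right_iff.1 this

theorem integral_norm_eval_sq {k : ℕ} (u : eigenspace 𝕂 d k) :
    ∫ x, ‖eval k x u‖ ^ 2 = ‖u‖ ^ 2 := by
  have h : ‖u‖ ^ 2 = inner ℝ (u : Lp 𝕂 2 (volume : Measure (FlatTorus d))) u :=
    (real_inner_self_eq_norm_sq _).symm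
  rw [h, L2.inner_def]
  refine integral_congr_ae ?_
  filter_upwards [coeFn_ae_eq_eval u] with x hx
  rw [hx, real_inner_self_eq_norm_sq]

/-- Somewhere, the spectral function is at least its average. -/
theorem exists_finrank_le_sum_norm_eval_sq (k : ℕ) {ι : Type*} [Fintype ι]
    (b : OrthonormalBasis ι ℝ (eigenspace 𝕂 d k)) :
    ∃ x, Module.finrank ℝ (eigenspace 𝕂 d k) ≤
      volume.real (univ : Set (FlatTorus d)) * ∑ i, ‖eval k x (b i)‖ ^ 2 := by
  have hint : ∀ i, Integrable (fun x => ‖eval k x (b i)‖ ^ 2)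
      (volume : Measure (FlatTorus d)) := fun i =>
    ((continuous_eval (b i)).norm.pow 2).integrable_of_hasCompactSupport
      (HasCompactSupport.of_compactSpace _)
  have hV : 0 < volume.real (univ : Set (FlatTorus d)) :=
    ENNReal.toReal_pos (isOpen_univ.measure_pos _ univ_nonempty).ne' (measure_ne_top _ _)
  obtain ⟨x, hx⟩ := exists_average_le (NeZero.ne (volume : Measure (FlatTorus d)))
    (integrable_finsetSum Finset.univ fun i _ => hint i)
  refine ⟨x, ?_⟩
  rw [average_eq, integral_finsetSum _ fun i _ => hint i, smul_eq_mul,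
    inv_mul_le_iff₀ hV] at hx
  refine le_trans (le_of_eq ?_) hx
  simp [integral_norm_eval_sq, b.orthonormal.1, Module.finrank_eq_card_basis b.toBasis]

/-- The vector `e` represents, up to normalization, the real or imaginary part of evaluation at a
point where the spectral function is at least its average. The larger of the two parts carries at
least half of that function, whence the 2 under the root. -/
theorem exists_unit_inner_le (k : ℕ) (hk : 0 < Module.finrank ℝ (eigenspace 𝕂 d k)) :
    ∃ e : eigenspace 𝕂 d k, ‖e‖ = 1 ∧ ∀ (u : eigenspace 𝕂 d k) (C : ℝ), 0 ≤ C →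
      eLpNorm (u : Lp 𝕂 2 (volume : Measure (FlatTorus d))) ⊤ volume ≤ ENNReal.ofReal C →
      inner ℝ e u ≤ C * √(2 * volume.real (univ : Set (FlatTorus d))) /
        √(Module.finrank ℝ (eigenspace 𝕂 d k)) := by
  set V := volume.real (univ : Set (FlatTorus d))
  have hV : 0 ≤ V := measureReal_nonneg
  set n := Module.finrank ℝ (eigenspace 𝕂 d k)
  have hn : (0 : ℝ) < n := by exact_mod_cast hk
  let b := stdOrthonormalBasis ℝ (eigenspace 𝕂 d k)
  obtain ⟨x, hx⟩ := exists_finrank_le_sum_norm_eval_sq k b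
  obtain ⟨l, hl, hln⟩ : ∃ l : eigenspace 𝕂 d k →ₗ[ℝ] ℝ, (∀ u, |l u| ≤ ‖eval k x u‖) ∧
      n ≤ 2 * V * ∑ i, l (b i) ^ 2 := by
    have hsum : ∑ i, ‖eval k x (b i)‖ ^ 2 =
        ∑ i, RCLike.re (eval k x (b i)) ^ 2 + ∑ i, RCLike.im (eval k x (b i)) ^ 2 := by
      rw [← Finset.sum_add_distrib]
      refine Finset.sum_congr rfl fun i _ => ?_
      rw [RCLike.norm_sq_eq_def, sq, sq]
    rw [hsum] at hx
    rcases le_total (∑ i, RCLike.re (eval k x (b i)) ^ 2)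
      (∑ i, RCLike.im (eval k x (b i)) ^ 2) with h | h
    · exact ⟨RCLike.imLm.comp (eval k x), fun u => RCLike.abs_im_le_norm _,
        hx.trans (by simp only [LinearMap.comp_apply, RCLike.imLm_coe]; nlinarith)⟩
    · exact ⟨RCLike.reLm.comp (eval k x), fun u => RCLike.abs_re_le_norm _,
        hx.trans (by simp only [LinearMap.comp_apply, RCLike.reLm_coe]; nlinarith)⟩
  have hpos : 0 < ∑ i, l (b i) ^ 2 := by
    refine (Finset.sum_nonneg fun i _ => sq_nonneg _).lt_of_ne fun h => ?_
    rw [← h, mul_zero] at hln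
    exact hln.not_gt hn
  obtain ⟨e, he, hel⟩ := exists_unit_inner_mul_eq b l hpos
  refine ⟨e, he, fun u C hC hu => ?_⟩
  have h1 : l u ≤ C := (le_abs_self _).trans ((hl u).trans (norm_eval_le hC hu x))
  set r := √(∑ i, l (b i) ^ 2)
  have hr : 0 < r := Real.sqrt_pos.2 hpos
  have h2 : √n ≤ √(2 * V) * r := by
    rw [← Real.sqrt_mul (by positivity)]
    exact Real.sqrt_le_sqrt hln
  have h3 : inner ℝ e u ≤ C / r := by rwa [le_div_iff₀ hr, hel]
  rw [le_div_iff₀ (Real.sqrt_pos.2 hn)]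
  calc inner ℝ e u * √n ≤ C / r * (√(2 * V) * r) := by gcongr
    _ = C * √(2 * V) := by field_simp

/-! ### Probability that a random sequence is bounded -/

/-- On large eigenspaces, a uniform random unit vector has a supremum norm larger than `C` with
probability bounded below. -/
theorem exists_uniformOnSphere_le (C : ℝ) (hC : 0 < C) :
    ∃ δ > 0, ∃ M : ℕ, 0 < M ∧ ∀ k, M ≤ Module.finrank ℝ (eigenspace 𝕂 d k) →
      ∃ A : Set (sphere (0 : eigenspace 𝕂 d k) 1), MeasurableSet A ∧
        {u : sphere (0 : eigenspace 𝕂 d k) 1 |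
          eLpNorm ((u : eigenspace 𝕂 d k) : Lp 𝕂 2 (volume : Measure (FlatTorus d))) ⊤ volume ≤
          ENNReal.ofReal C} ⊆ A ∧
        uniformOnSphere (eigenspace 𝕂 d k) A ≤ 1 - δ := by
  -- The 2 is what the cap estimate requires; the other term is the height that a function bounded
  -- by `C` cannot exceed.
  set c : ℝ := max 2 (C * √(2 * volume.real (univ : Set (FlatTorus d))))
  refine ⟨ENNReal.ofReal (3 / 8 * Real.exp (-(6 * c ^ 2))), by simp; positivity,
    ⌈6 * c ^ 2⌉₊ + 1, Nat.succ_pos _, fun k hk => ?_⟩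
  have hn : 6 * c ^ 2 ≤ Module.finrank ℝ (eigenspace 𝕂 d k) := by
    refine (Nat.le_ceil _).trans ?_
    exact_mod_cast (Nat.le_succ _).trans hk
  obtain ⟨e, he, hu⟩ := exists_unit_inner_le k ((Nat.succ_pos _).trans_le hk)
  have hcont : Continuous fun w : sphere (0 : eigenspace 𝕂 d k) 1 =>
    (inner ℝ e (w : eigenspace 𝕂 d k) : ℝ) := by fun_prop
  have hmeas : MeasurableSet {w : sphere (0 : eigenspace 𝕂 d k) 1 |
      c / √(Module.finrank ℝ (eigenspace 𝕂 d k)) < inner ℝ e (w : eigenspace 𝕂 d k)} :=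
    measurableSet_lt measurable_const hcont.measurable
  have : Nontrivial (eigenspace 𝕂 d k) :=
    Module.nontrivial_of_finrank_pos (R := ℝ) ((Nat.succ_pos _).trans_le hk)
  refine ⟨_, hmeas.compl, fun u hu' => ?_, ?_⟩
  · refine not_lt.2 ((hu u C hC.le hu').trans ?_)
    gcongr
    exact le_max_right _ _
  · rw [prob_compl_eq_one_sub hmeas]
    exact tsub_le_tsub_left (uniformOnSphere_cap_ge (le_max_left _ _) hn he) _

theorem mem_spectrum_of_finrank_real_pos {k : ℕ}
    (hk : 0 < Module.finrank ℝ (eigenspace 𝕂 d k)) : k ∈ spectrum 𝕂 d := by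
  have : Nontrivial (eigenspace 𝕂 d k) := Module.nontrivial_of_finrank_pos (R := ℝ) hk
  -- Without finiteness over `𝕂`, `finrank` could take its default value 0.
  have : Module.Finite 𝕂 (eigenspace 𝕂 d k) := Module.Finite.of_restrictScalars_finite ℝ 𝕂 _
  exact Module.finrank_pos (R := 𝕂)

/-- Any `T` large eigenspaces impose `T` independent constraints, each of probability at most `1 -
δ`. -/
theorem unitSequenceLaw_setOf_bounded_by (hd : 2 ≤ d) (C : ℝ) (hC : 0 < C) :
    unitSequenceLaw 𝕂 d {U | ∀ k : spectrum 𝕂 d,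
      eLpNorm ((U k : eigenspace 𝕂 d k) : Lp 𝕂 2 (volume : Measure (FlatTorus d))) ⊤ volume ≤
        ENNReal.ofReal C} = 0 := by
  obtain ⟨δ, hδ, M, hM, h⟩ := exists_uniformOnSphere_le (𝕂 := 𝕂) (d := d) C hC
  have hlim : Filter.Tendsto (fun T : ℕ => (1 - δ) ^ T) Filter.atTop (nhds 0) :=
    ENNReal.tendsto_pow_atTop_nhds_zero_of_lt_one
      (ENNReal.sub_lt_self ENNReal.one_ne_top one_ne_zero hδ.ne')
  refine le_antisymm (ge_of_tendsto' hlim fun T => ?_) zero_le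
  let S : Set (spectrum 𝕂 d) := {k | M ≤ Module.finrank ℝ (eigenspace 𝕂 d k)}
  have hS : S.Infinite := by
    refine Set.Infinite.of_image Subtype.val ?_
    convert infinite_setOf_le_finrank_eigenspace (𝕂 := 𝕂) hd M
    ext k
    refine ⟨?_, fun hk => ⟨⟨k, mem_spectrum_of_finrank_real_pos (hM.trans_le hk)⟩, hk, rfl⟩⟩
    rintro ⟨k, hk, rfl⟩
    exact hk
  obtain ⟨F, hFS, hFT⟩ := hS.exists_subset_card_eq T
  -- The product formula needs measurable factors, so each sup-norm event is enlarged to the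
  -- measurable complement of a cap. Outside `S` the choice is arbitrary.
  have h' : ∀ k : spectrum 𝕂 d, ∃ A : Set (sphere (0 : eigenspace 𝕂 d k) 1), k ∈ S →
      (MeasurableSet A ∧
        {u : sphere (0 : eigenspace 𝕂 d k) 1 |
          eLpNorm ((u : eigenspace 𝕂 d k) : Lp 𝕂 2 (volume : Measure (FlatTorus d))) ⊤ volume ≤
          ENNReal.ofReal C} ⊆ A ∧
        uniformOnSphere (eigenspace 𝕂 d k) A ≤ 1 - δ) := fun k => by
    by_cases hk : k ∈ S
    · obtain ⟨A, hA⟩ := h k hk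
      exact ⟨A, fun _ => hA⟩
    · exact ⟨∅, fun h => absurd h hk⟩
  choose A hA using h'
  calc unitSequenceLaw 𝕂 d {U | ∀ k : spectrum 𝕂 d,
      eLpNorm ((U k : eigenspace 𝕂 d k) : Lp 𝕂 2 (volume : Measure (FlatTorus d))) ⊤ volume ≤
        ENNReal.ofReal C}
      ≤ unitSequenceLaw 𝕂 d ((F : Set (spectrum 𝕂 d)).pi A) :=
        measure_mono fun U hU k hk => (hA k (hFS hk)).2.1 (hU k)
    _ = ∏ k ∈ F, uniformOnSphere (eigenspace 𝕂 d k) (A k) :=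
        Measure.infinitePi_pi _ fun k hk => (hA k (hFS hk)).1
    _ ≤ ∏ _k ∈ F, (1 - δ) := Finset.prod_le_prod' fun k hk => (hA k (hFS hk)).2.2
    _ = (1 - δ) ^ T := by rw [Finset.prod_const, hFT]

end FlatTorus

end

theorem mainTheorem4 (𝕂 : Type*) [RCLike 𝕂] (d : ℕ) (hd : 2 ≤ d) :
    FlatTorus.unitSequenceLaw 𝕂 d
      {U : FlatTorus.UnitSequence 𝕂 d | ∃ C : ℝ, 0 < C ∧ ∀ k : FlatTorus.spectrum 𝕂 d,
        eLpNorm ((U k : FlatTorus.eigenspace 𝕂 d k) : Lp 𝕂 2 (volume : Measure (FlatTorus d)))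
          ⊤ volume ≤ ENNReal.ofReal C} = 0 := by
  -- Bounds `N + 1` make the union countable while staying positive.
  refine measure_mono_null (t := ⋃ N : ℕ, {U | ∀ k : FlatTorus.spectrum 𝕂 d,
    eLpNorm ((U k : FlatTorus.eigenspace 𝕂 d k) : Lp 𝕂 2 (volume : Measure (FlatTorus d)))
      ⊤ volume ≤ ENNReal.ofReal (N + 1 : ℝ)}) ?_ (measure_iUnion_null fun N =>
        FlatTorus.unitSequenceLaw_setOf_bounded_by hd _ (by positivity))
  rintro U ⟨C, -, hC⟩
  obtain ⟨N, hN⟩ := exists_nat_ge C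
  exact mem_iUnion.2 ⟨N, fun k => (hC k).trans (ENNReal.ofReal_le_ofReal (by linarith))⟩
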